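/- Let $P\subset\mathbb{R}^n$ be a polytope, i.e. the convex hull of a finite set of points or a bounded intersection of finitely many closed halfspaces. A linear function $c$ on $\mathbb{R}^n$ is in general position with respect to $P$ if $c(v)\neq c(w)$ for any two distinct vertices $v,w$ of $P$. Such a $c$ orients the graph $G(P)$ of vertices and edges of $P$, an edge $[v,w]$ being directed from $v$ to $w$ if $c(v)>c(w)$; for a face $F$ of $P$, a sink of $F$ is a vertex of $F$ from which no edge of $P$ is directed to another vertex of $F$. A triangulation of a polytope is a finite simplicial complex whose underlying set is the polytope. A triangulation $\mathcal{C}_P$ of $P$ is called a pointed triangulation with apexes $\mathbf{v}_F$ ($F$ a nonempty face of $P$) if, writing $\mathcal{C}_F=\{\sigma\in\mathcal{C}_P : \sigma\subseteq F\}$: 1. for each nonempty face $F$ of $P$, with $k=\dim F$, $\mathcal{C}_F$ is a triangulation of $F$ in which every simplex is a face of a $k$-simplex of $\mathcal{C}_F$, $\mathbf{v}_F$ is a vertex of $F$, and every $k$-simplex of $\mathcal{C}_F$ contains $\mathbf{v}_F$; 2. if $F_1,F_2$ are nonempty faces of $P$ with $\{\mathbf{v}_{F_1},\mathbf{v}_{F_2}\}\subseteq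 F_1\cap F_2$, then $\mathbf{v}_{F_1}=\mathbf{v}_{F_2}$; 3. for each nonempty face $F$ of $P$ and each vertex $w\neq\mathbf{v}_F$ of $F$, the edge $\operatorname{conv}\{\mathbf{v}_F,w\}$ belongs to $\mathcal{C}_F$. **Theorem.** Every polytope $P$ has a pointed triangulation. More precisely, there is a linear function in general position with respect to $P$; and for every such linear function $c$, each nonempty face $F$ of $P$ has exactly one sink in the orientation induced by $c$, and $P$ has a pointed triangulation in which the apex $\mathbf{v}_F$ of every nonempty face $F$ is this sink. -/

import Mathlib

namespace PointedTriangulation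

open Geometry

variable {E : Type*} [NormedAddCommGroup E] [NormedSpace ℝ E]

/-- A V-polytope: the convex hull of a finite set of points (the empty set is allowed). -/
def IsVPolytope (P : Set E) : Prop :=
  ∃ s : Finset E, P = convexHull ℝ (s : Set E)

/-- An H-polytope: a bounded intersection of finitely many closed halfspaces `a i x ≤ z i`. -/
def IsHPolytope (P : Set E) : Prop :=
  Bornology.IsBounded P ∧
    ∃ (m : ℕ) (a : Fin m → StrongDual ℝ E) (z : Fin m → ℝ), P = {x | ∀ i, a i x ≤ z i}

/-- A polytope is a point set that is a V-polytope or an H-polytope. -/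
def IsPolytope (P : Set E) : Prop :=
  IsVPolytope P ∨ IsHPolytope P

/-- `F` is a nonempty face of `P`: the set of maximizers on `P` of some linear function
(`P` itself is a face, through the zero function). -/
def IsNonemptyFace (P F : Set E) : Prop :=
  IsExposed ℝ P F ∧ F.Nonempty

/-- The vertices of `P`: the points `v` such that `{v}` is a face of `P`. -/
def vert (P : Set E) : Set E := P.exposedPoints ℝ

/-- The dimension of a nonempty set: the dimension of its affine hull. -/
noncomputable def dim (S : Set E) : ℕ := Module.finrank ℝ (vectorSpan ℝ S)

/-- The linear function `c` is in general position with respect to `P`: it separates the vertices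
of `P`. -/
def InGeneralPosition (P : Set E) (c : StrongDual ℝ E) : Prop :=
  ∀ v ∈ vert P, ∀ w ∈ vert P, v ≠ w → c v ≠ c w

/-- The graph of `P`: two distinct vertices are adjacent if the segment between them is a face
(an edge) of `P`. -/
def graph (P : Set E) : SimpleGraph E where
  Adj v w := v ≠ w ∧ v ∈ vert P ∧ w ∈ vert P ∧ IsExposed ℝ P (segment ℝ v w)
  symm := ⟨fun v w h => ⟨h.1.symm, h.2.2.1, h.2.1, segment_symm ℝ v w ▸ h.2.2.2⟩⟩

/-- In the orientation of the graph of `P` induced by `c`, an edge is directed from `v` to `w` if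
`c v > c w`. -/
def DirectedEdge (P : Set E) (c : StrongDual ℝ E) (v w : E) : Prop :=
  (graph P).Adj v w ∧ c v > c w

/-- `v` is a sink of the graph of the face `F`, i.e. of the subgraph of the graph of `P` induced on
the vertices of `F`, for the orientation induced by `c`. -/
def IsSink (P : Set E) (c : StrongDual ℝ E) (F : Set E) (v : E) : Prop :=
  v ∈ vert F ∧ ∀ w ∈ vert F, ¬ DirectedEdge P c v w

/-- `K` is a triangulation of `P`: a finite simplicial complex with underlying set `P`. -/
def IsTriangulation (P : Set E) (K : SimplicialComplex ℝ E) : Prop :=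
  K.faces.Finite ∧ K.space = P

/-- The subcomplex of `K` formed by the simplices of `K` that are contained in `F`. -/
def restrict (K : SimplicialComplex ℝ E) (F : Set E) : SimplicialComplex ℝ E where
  faces := {s | s ∈ K.faces ∧ convexHull ℝ (s : Set E) ⊆ F}
  isRelLowerSet_faces := fun _ hs => ⟨K.nonempty_of_mem_faces hs.1, fun _ hts ht =>
    ⟨K.down_closed hs.1 hts ht, (convexHull_mono (Finset.coe_subset.2 hts)).trans hs.2⟩⟩
  indep := fun hs => K.indep hs.1
  inter_subset_convexHull := fun hs ht => K.inter_subset_convexHull hs.1 ht.1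

/-- `K` is a pointed triangulation of `P`, where `apex F` is the apex of the nonempty face `F`
(the values of `apex` on other sets are irrelevant). The triangulation of `F` is the one
that `K` induces on `F`. -/
structure IsPointedTriangulation (P : Set E) (K : SimplicialComplex ℝ E) (apex : Set E → E) :
    Prop where
  triangulation : IsTriangulation P K
  /-- `K` induces a triangulation of each nonempty face. -/
  face_triangulation : ∀ F, IsNonemptyFace P F → IsTriangulation F (restrict K F)
  /-- The triangulation of a `k`-face is generated by its `k`-simplices. -/
  face_pure : ∀ F, IsNonemptyFace P F → ∀ s ∈ (restrict K F).faces,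
    ∃ t ∈ (restrict K F).faces, s ⊆ t ∧ t.card = dim F + 1
  apex_mem_vert : ∀ F, IsNonemptyFace P F → apex F ∈ vert F
  /-- Each `k`-simplex in the triangulation of a `k`-face contains the apex of this face. -/
  apex_mem_simplex : ∀ F, IsNonemptyFace P F → ∀ t ∈ (restrict K F).faces,
    t.card = dim F + 1 → apex F ∈ convexHull ℝ (t : Set E)
  apex_compatible : ∀ F₁ F₂, IsNonemptyFace P F₁ → IsNonemptyFace P F₂ →
    apex F₁ ∈ F₁ ∩ F₂ → apex F₂ ∈ F₁ ∩ F₂ → apex F₁ = apex F₂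
  /-- The edge between the apex and any other vertex of a face is in the triangulation of it. -/
  apex_edge : ∀ F, IsNonemptyFace P F → ∀ w ∈ vert F, w ≠ apex F →
    ∃ e ∈ (restrict K F).faces, (e : Set E) = {apex F, w}

end PointedTriangulation

namespace PointedTriangulation

open Geometry

variable {E : Type*} [NormedAddCommGroup E] [NormedSpace ℝ E]

/-! ### Linear inequalities on finite sets -/

theorem exists_pos_forall_add_mul_neg {ι : Type*} {S : Set ι} (hS : S.Finite) (a b : ι → ℝ)
    (h : ∀ x ∈ S, a x < 0) : ∃ ε > 0, ∀ x ∈ S, a x + ε * b x < 0 := by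
  have key : ∀ᶠ ε in nhdsWithin (0 : ℝ) (Set.Ioi 0), ∀ x ∈ S, a x + ε * b x < 0 := by
    rw [Filter.eventually_all_finite hS]
    intro x hx
    have hc : Continuous fun ε : ℝ => a x + ε * b x := by fun_prop
    have h0 : a x + (0 : ℝ) * b x < 0 := by simpa using h x hx
    exact nhdsWithin_le_nhds (hc.continuousAt.eventually_lt continuousAt_const h0)
  obtain ⟨ε, hε, hpos⟩ := (key.and self_mem_nhdsWithin).exists
  exact ⟨ε, hpos, hε⟩

/-- Tilting a valid inequality `f ≤ M` in the direction of `g` until it becomes tight at a point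
with `μ < g`. -/
theorem exists_tilt {ι : Type*} {S : Set ι} (hS : S.Finite) (f g : ι → ℝ) (M μ : ℝ)
    (hf : ∀ x ∈ S, f x ≤ M) (hfg : ∀ x ∈ S, μ < g x → f x < M) (hne : ∃ x ∈ S, μ < g x) :
    ∃ r > 0, (∀ x ∈ S, f x + r * g x ≤ M + r * μ) ∧
      ∃ x ∈ S, μ < g x ∧ f x + r * g x = M + r * μ := by
  obtain ⟨w, ⟨hwS, hw⟩, hmin⟩ := Set.exists_min_image {x ∈ S | μ < g x}
    (fun x => (M - f x) / (g x - μ)) (hS.subset (Set.sep_subset _ _)) hne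
  have hw' : 0 < g w - μ := sub_pos.2 hw
  refine ⟨(M - f w) / (g w - μ), div_pos (sub_pos.2 (hfg w hwS hw)) hw', fun x hx => ?_,
    w, hwS, hw, ?_⟩
  · rcases lt_or_ge μ (g x) with h | h
    · have := hmin x ⟨hx, h⟩
      rw [le_div_iff₀ (sub_pos.2 h)] at this
      linarith
    · have h1 : 0 < (M - f w) / (g w - μ) := div_pos (sub_pos.2 (hfg w hwS hw)) hw'
      have := mul_le_mul_of_nonneg_left h h1.le
      linarith [hf x hx]
  · have : (M - f w) / (g w - μ) * (g w - μ) = M - f w := div_mul_cancel₀ _ hw'.ne'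
    linarith

/-- **Farkas' lemma** for a finitely generated cone. -/
theorem exists_nonneg_combination {ι : Type*} (S : Finset ι) (a : ι → E) (g : E)
    (h : ∀ l : StrongDual ℝ E, (∀ i ∈ S, l (a i) ≤ 0) → l g ≤ 0) :
    ∃ w : ι → ℝ, (∀ i ∈ S, 0 ≤ w i) ∧ g = ∑ i ∈ S, w i • a i := by
  classical
  induction S using Finset.induction_on generalizing a g with
  | empty =>
    refine ⟨0, by simp, ?_⟩
    rw [Finset.sum_empty]
    refine SeparatingDual.eq_zero_of_forall_dual_eq_zero (R := ℝ) fun l => ?_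
    have h1 := h l (by simp)
    have h2 := h (-l) (by simp)
    simp only [neg_apply] at h2
    linarith
  | insert j S hj ih =>
    by_cases hS : ∀ l : StrongDual ℝ E, (∀ i ∈ S, l (a i) ≤ 0) → l g ≤ 0
    · obtain ⟨w, hw, hg⟩ := ih a g hS
      refine ⟨fun i => if i = j then 0 else w i, fun i hi => ?_, ?_⟩
      · dsimp only
        split_ifs with hij
        · rfl
        · exact hw i (Finset.mem_of_mem_insert_of_ne hi hij)
      · rw [Finset.sum_insert hj, hg]
        simp only [if_true, zero_smul, zero_add]
        exact Finset.sum_congr rfl fun i hi => by rw [if_neg (ne_of_mem_of_not_mem hi hj)]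
    · push Not at hS
      obtain ⟨l, hl, hlg⟩ := hS
      have hlj : 0 < l (a j) := by
        by_contra! hcon
        refine hlg.not_ge (h l fun i hi => ?_)
        rcases Finset.mem_insert.1 hi with rfl | hi
        exacts [hcon, hl i hi]
      obtain ⟨k, hk⟩ : ∃ k, k = (l (a j))⁻¹ • l := ⟨_, rfl⟩
      have hkj : k (a j) = 1 := by simp [hk, hlj.ne']
      have hkS : ∀ i ∈ S, k (a i) ≤ 0 := fun i hi => by
        simpa [hk] using mul_nonpos_of_nonneg_of_nonpos (inv_pos.2 hlj).le (hl i hi)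
      have hkg : 0 < k g := by simpa [hk] using mul_pos (inv_pos.2 hlj) hlg
      obtain ⟨w, hw, hg⟩ := ih (fun i => a i - k (a i) • a j) (g - k g • a j) fun m hm => by
        have := h (m - m (a j) • k) fun i hi => by
          rcases Finset.mem_insert.1 hi with rfl | hi
          · simp [hkj]
          · have := hm i hi
            simp only [map_sub, map_smul, smul_eq_mul, sub_apply, smul_apply] at this ⊢
            linarith
        simp only [map_sub, map_smul, smul_eq_mul, sub_apply, smul_apply] at this ⊢
        linarith
      have hneg : ∑ i ∈ S, w i * k (a i) ≤ 0 :=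
        Finset.sum_nonpos fun i hi => mul_nonpos_of_nonneg_of_nonpos (hw i hi) (hkS i hi)
      refine ⟨fun i => if i = j then k g - ∑ i ∈ S, w i * k (a i) else w i, fun i hi => ?_, ?_⟩
      · dsimp only
        split_ifs with hij
        · linarith
        · exact hw i (Finset.mem_of_mem_insert_of_ne hi hij)
      · have hS : ∑ i ∈ S, (if i = j then k g - ∑ i ∈ S, w i * k (a i) else w i) • a i =
            ∑ i ∈ S, w i • a i :=
          Finset.sum_congr rfl fun i hi => by rw [if_neg (ne_of_mem_of_not_mem hi hj)]
        rw [Finset.sum_insert hj, hS]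
        simp only [if_true, smul_sub, Finset.sum_sub_distrib, smul_smul, ← Finset.sum_smul] at hg ⊢
        rw [sub_smul, ← sub_eq_zero, ← sub_eq_zero.2 hg]
        abel

/-! ### Faces of V-polytopes -/

theorem le_of_mem_convexHull {S : Set E} {l : StrongDual ℝ E} {M : ℝ} (h : ∀ x ∈ S, l x ≤ M) :
    ∀ x ∈ convexHull ℝ S, l x ≤ M :=
  fun _ hx => convexHull_min (t := {x | l x ≤ M}) h (convex_halfSpace_le l.isLinear M) hx

theorem isExposed_setOf_eq {P : Set E} {l : StrongDual ℝ E} {M : ℝ} (h : ∀ x ∈ P, l x ≤ M) :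
    IsExposed ℝ P {x ∈ P | l x = M} := by
  rintro ⟨w, hw, rfl⟩
  exact ⟨l, Set.ext fun x => ⟨fun hx => ⟨hx.1, fun y hy => (h y hy).trans_eq hx.2.symm⟩,
    fun hx => ⟨hx.1, (h x hx.1).antisymm (hx.2 w hw)⟩⟩⟩

theorem exists_eq_setOf_of_isExposed {P F : Set E} (hF : IsExposed ℝ P F) (hne : F.Nonempty) :
    ∃ (l : StrongDual ℝ E) (M : ℝ), (∀ x ∈ P, l x ≤ M) ∧ F = {x ∈ P | l x = M} := by
  obtain ⟨l, hl⟩ := hF hne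
  obtain ⟨w, hw⟩ := hne
  rw [hl] at hw
  refine ⟨l, l w, hw.2, hl.trans (Set.ext fun x => ⟨fun hx => ⟨hx.1, ?_⟩, fun hx => ⟨hx.1, ?_⟩⟩)⟩
  · exact (hw.2 x hx.1).antisymm (hx.2 w hw.1)
  · exact fun y hy => (hw.2 y hy).trans_eq hx.2.symm

/-- If a positive combination of points of `P` lies on an exposed face, so do the points. -/
theorem subset_face_of_sum_eq {P F : Set E} (hF : IsExposed ℝ P F) {s t : Finset E}
    (hs : (s : Set E) ⊆ P) (ht : (t : Set E) ⊆ F) {a b : E → ℝ} (ha : ∀ x ∈ s, 0 < a x)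
    (hsum : ∑ x ∈ s, a x = ∑ x ∈ t, b x) (hvec : ∑ x ∈ s, a x • x = ∑ x ∈ t, b x • x)
    (hne : t.Nonempty) : (s : Set E) ⊆ F := by
  obtain ⟨l, M, hl, rfl⟩ := exists_eq_setOf_of_isExposed hF (hne.to_set.mono ht)
  have h0 : ∑ x ∈ s, a x * (M - l x) = 0 := by
    have h1 := congrArg l hvec
    simp only [map_sum, map_smul, smul_eq_mul] at h1
    have h2 : ∑ x ∈ t, b x * l x = ∑ x ∈ t, b x * M :=
      Finset.sum_congr rfl fun x hx => by rw [(ht hx).2]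
    rw [h2, ← Finset.sum_mul, ← hsum, Finset.sum_mul] at h1
    simp only [mul_sub, Finset.sum_sub_distrib, h1, sub_self]
  rw [Finset.sum_eq_zero_iff_of_nonneg fun x hx =>
    mul_nonneg (ha x hx).le (sub_nonneg.2 (hl x (hs hx)))] at h0
  intro x hx
  refine ⟨hs hx, ?_⟩
  rcases mul_eq_zero.1 (h0 x hx) with h | h
  · exact absurd h (ha x hx).ne'
  · linarith

theorem exists_pos_combination {s : Finset E} {p : E} (hp : p ∈ convexHull ℝ (s : Set E)) :
    ∃ u ⊆ s, ∃ a : E → ℝ, (∀ x ∈ u, 0 < a x) ∧ ∑ x ∈ u, a x = 1 ∧ ∑ x ∈ u, a x • x = p := by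
  classical
  obtain ⟨w, hw, hw1, hwp⟩ := Finset.mem_convexHull'.1 hp
  refine ⟨s.filter fun x => 0 < w x, Finset.filter_subset _ _, w,
    fun x hx => (Finset.mem_filter.1 hx).2, ?_, ?_⟩
  · rw [← hw1]
    exact Finset.sum_filter_of_ne fun x hx h => (hw x hx).lt_of_ne' h
  · rw [← hwp]
    exact Finset.sum_filter_of_ne fun x hx h => (hw x hx).lt_of_ne' fun h' => h (by simp [h'])

theorem isExposed_convexHull_eq {S : Finset E} {F : Set E}
    (hF : IsExposed ℝ (convexHull ℝ (S : Set E)) F) : F = convexHull ℝ ((S : Set E) ∩ F) := by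
  have hconv := hF.convex (convex_convexHull ℝ _)
  refine Set.Subset.antisymm (fun p hp => ?_) (convexHull_min Set.inter_subset_right hconv)
  obtain ⟨u, hu, a, ha, ha1, hap⟩ := exists_pos_combination (hF.subset hp)
  have huS : (u : Set E) ⊆ S := Finset.coe_subset.2 hu
  have huF : (u : Set E) ⊆ F :=
    subset_face_of_sum_eq hF (t := {p}) (b := 1) (huS.trans (subset_convexHull ℝ _))
      (by simpa using hp) ha (by simpa using ha1) (by simpa using hap) (by simp)
  exact convexHull_mono (Set.subset_inter huS huF)
    (Finset.mem_convexHull'.2 ⟨a, fun x hx => (ha x hx).le, ha1, hap⟩)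

theorem IsVPolytope.isExposed {P F : Set E} (hP : IsVPolytope P) (hF : IsExposed ℝ P F) :
    IsVPolytope F := by
  classical
  obtain ⟨S, rfl⟩ := hP
  exact ⟨S.filter (· ∈ F), by rw [Finset.coe_filter]; exact isExposed_convexHull_eq hF⟩

theorem IsVPolytope.isCompact {P : Set E} (hP : IsVPolytope P) : IsCompact P := by
  obtain ⟨S, rfl⟩ := hP
  exact S.finite_toSet.isCompact_convexHull ℝ

theorem IsVPolytope.convex {P : Set E} (hP : IsVPolytope P) : Convex ℝ P := by
  obtain ⟨S, rfl⟩ := hP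
  exact convex_convexHull ℝ _

theorem vert_convexHull_subset (S : Set E) : vert (convexHull ℝ S) ⊆ S :=
  exposedPoints_subset_extremePoints.trans extremePoints_convexHull_subset

theorem vert_subset (P : Set E) : vert P ⊆ P := exposedPoints_subset

theorem IsVPolytope.finite_vert {P : Set E} (hP : IsVPolytope P) : (vert P).Finite := by
  obtain ⟨S, rfl⟩ := hP
  exact S.finite_toSet.subset (vert_convexHull_subset _)

theorem IsVPolytope.extremePoints_subset_vert {P : Set E} (hP : IsVPolytope P) :
    P.extremePoints ℝ ⊆ vert P := by
  classical
  obtain ⟨S, rfl⟩ := hP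
  intro x hx
  have hxS : x ∈ S := extremePoints_convexHull_subset hx
  have hxn : x ∉ convexHull ℝ ((S.erase x : Finset E) : Set E) := by
    have := ((convex_convexHull ℝ _).mem_extremePoints_iff_mem_sdiff_convexHull_sdiff.1 hx).2
    refine fun h => this (convexHull_mono ?_ h)
    rw [Finset.coe_erase]
    exact Set.sdiff_subset_sdiff_left (subset_convexHull ℝ _)
  obtain ⟨l, u, hlu, hux⟩ := geometric_hahn_banach_closed_point
    (convex_convexHull ℝ _) ((S.erase x).finite_toSet.isClosed_convexHull ℝ) hxn
  have hlS : ∀ y ∈ (S : Set E), l y ≤ l x := fun y hy => by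
    by_cases hyx : y = x
    · rw [hyx]
    · exact ((hlu y (subset_convexHull ℝ _ (by simp [hyx]; exact hy))).trans hux).le
  have hexp := isExposed_setOf_eq (le_of_mem_convexHull hlS)
  have heq := isExposed_convexHull_eq hexp
  have hsub : (S : Set E) ∩ {y ∈ convexHull ℝ (S : Set E) | l y = l x} ⊆ {x} := by
    rintro y ⟨hy, -, hyx⟩
    by_contra hne
    exact ((hlu y (subset_convexHull ℝ _ (by simp at hne; simp [hne]; exact hy))).trans hux).ne hyx
  refine ⟨hx.1, l, fun y hy => ⟨le_of_mem_convexHull hlS y hy, fun hxy => ?_⟩⟩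
  have hy' : y ∈ {y ∈ convexHull ℝ (S : Set E) | l y = l x} :=
    ⟨hy, (le_of_mem_convexHull hlS y hy).antisymm hxy⟩
  rw [heq] at hy'
  simpa using convexHull_mono hsub hy'

theorem IsVPolytope.convexHull_vert {P : Set E} (hP : IsVPolytope P) :
    convexHull ℝ (vert P) = P := by
  refine Set.Subset.antisymm (convexHull_min (vert_subset P) hP.convex) ?_
  conv_lhs => rw [← closure_convexHull_extremePoints hP.isCompact hP.convex]
  exact closure_minimal (convexHull_mono hP.extremePoints_subset_vert)
    (hP.finite_vert.isClosed_convexHull ℝ)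

theorem IsVPolytope.le_of_forall_vert {P : Set E} (hP : IsVPolytope P) {l : StrongDual ℝ E}
    {M : ℝ} (h : ∀ x ∈ vert P, l x ≤ M) : ∀ x ∈ P, l x ≤ M := by
  have := le_of_mem_convexHull h
  rwa [hP.convexHull_vert] at this

theorem IsVPolytope.isExposed_eq_convexHull {P F : Set E} (hP : IsVPolytope P)
    (hF : IsExposed ℝ P F) : F = convexHull ℝ (vert P ∩ F) := by
  have hfin := hP.finite_vert
  have h := isExposed_convexHull_eq (S := hfin.toFinset) (F := F)
  rw [hfin.coe_toFinset, hP.convexHull_vert] at h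
  exact h hF

/-- Exposed faces of exposed faces of a polytope are exposed. -/
theorem IsVPolytope.isExposed_trans {P F G : Set E} (hP : IsVPolytope P)
    (hF : IsExposed ℝ P F) (hG : IsExposed ℝ F G) : IsExposed ℝ P G := by
  rcases G.eq_empty_or_nonempty with rfl | hne
  · exact isExposed_empty
  obtain ⟨m, μ, hm, hGm⟩ := exists_eq_setOf_of_isExposed hG hne
  obtain ⟨l, M, hl, hFl⟩ := exists_eq_setOf_of_isExposed hF (hne.mono hG.subset)
  obtain ⟨ε, hε, hlt⟩ := exists_pos_forall_add_mul_neg (S := vert P \ F)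
    (hP.finite_vert.subset Set.sdiff_subset) (fun x => l x - M) (fun x => m x - μ)
    fun x hx => sub_neg.2 <| (hl x (vert_subset P hx.1)).lt_of_ne fun h =>
      hx.2 (by rw [hFl]; exact ⟨vert_subset P hx.1, h⟩)
  have hF' : ∀ x ∈ F, l x = M := fun x hx => by rw [hFl] at hx; exact hx.2
  have hle : ∀ x ∈ vert P, (l + ε • m) x ≤ M + ε * μ := fun x hx => by
    simp only [add_apply, smul_apply, smul_eq_mul]
    by_cases hxF : x ∈ F
    · rw [hF' x hxF]
      linarith [mul_le_mul_of_nonneg_left (hm x hxF) hε.le]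
    · linarith [hlt x ⟨hx, hxF⟩]
  have hexp := isExposed_setOf_eq (hP.le_of_forall_vert hle)
  suffices h : {x ∈ P | (l + ε • m) x = M + ε * μ} = G by rwa [h] at hexp
  refine Set.Subset.antisymm ?_ fun x hx => ⟨hF.subset (hG.subset hx), ?_⟩
  · rw [hP.isExposed_eq_convexHull hexp]
    refine convexHull_min ?_ (hG.convex (hF.convex hP.convex))
    rintro x ⟨hx, -, hx'⟩
    simp only [add_apply, smul_apply, smul_eq_mul] at hx'
    have hxF : x ∈ F := by
      by_contra hxF
      linarith [hlt x ⟨hx, hxF⟩]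
    rw [hF' x hxF] at hx'
    rw [hGm]
    exact ⟨hxF, mul_left_cancel₀ hε.ne' (by linarith)⟩
  · rw [add_apply, smul_apply, smul_eq_mul, hF' x (hG.subset hx)]
    rw [hGm] at hx
    rw [hx.2]

theorem IsVPolytope.vert_face {P F : Set E} (hP : IsVPolytope P) (hF : IsExposed ℝ P F) :
    vert F = vert P ∩ F := by
  ext x
  simp only [vert, Set.mem_inter_iff, mem_exposedPoints_iff_exposed_singleton]
  refine ⟨fun h => ⟨hP.isExposed_trans hF h, h.subset rfl⟩, fun h => ?_⟩
  exact h.1.mono hF.subset (by simpa using h.2)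

theorem IsVPolytope.ncard_vert_lt {P F : Set E} (hP : IsVPolytope P) (hF : IsExposed ℝ P F)
    (hne : F ≠ P) : (vert F).ncard < (vert P).ncard := by
  refine Set.ncard_lt_ncard ?_ hP.finite_vert
  rw [hP.vert_face hF]
  refine Set.inter_subset_left.ssubset_of_ne fun h => hne ?_
  rw [hP.isExposed_eq_convexHull hF, h, hP.convexHull_vert]

theorem IsVPolytope.exists_vert_forall_le {P : Set E} (hP : IsVPolytope P) (hne : P.Nonempty)
    (c : StrongDual ℝ E) : ∃ v ∈ vert P, ∀ x ∈ P, c v ≤ c x := by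
  have hv : (vert P).Nonempty := by
    rw [← convexHull_nonempty_iff (𝕜 := ℝ), hP.convexHull_vert]; exact hne
  obtain ⟨v, hv, hmin⟩ := Set.exists_min_image (vert P) c hP.finite_vert hv
  refine ⟨v, hv, fun x hx => ?_⟩
  have := hP.le_of_forall_vert (l := -c) (M := -c v) (fun y hy => by simpa using hmin y hy) x hx
  simpa using this

/-! ### Edges, facets and visible faces of a polytope -/

/-- A vertex that does not minimize `c` has an edge along which `c` decreases. -/
theorem IsVPolytope.exists_edge_lt {F : Set E} (hF : IsVPolytope F) {c : StrongDual ℝ E} {v : E}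
    (hv : v ∈ vert F) (hlt : ∃ w ∈ F, c w < c v) :
    ∃ w ∈ vert F, c w < c v ∧ IsExposed ℝ F (segment ℝ v w) := by
  induction hn : (vert F).ncard using Nat.strong_induction_on generalizing F with
  | _ n ih =>
  subst hn
  by_cases hG : ∃ G, IsExposed ℝ F G ∧ G ≠ F ∧ v ∈ G ∧ ∃ w ∈ G, c w < c v
  · obtain ⟨G, hG, hne, hvG, hw⟩ := hG
    obtain ⟨w, hw, hlt, hexp⟩ := ih _ (hF.ncard_vert_lt hG hne) (hF.isExposed hG)
      (by rw [hF.vert_face hG]; exact ⟨hv, hvG⟩) hw rfl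
    rw [hF.vert_face hG] at hw
    exact ⟨w, hw.1, hlt, hF.isExposed_trans hG hexp⟩
  push Not at hG
  have hvF := vert_subset F hv
  obtain ⟨u, hu, hmin⟩ := hF.exists_vert_forall_le ⟨v, hvF⟩ c
  have huv : c u < c v := by
    obtain ⟨w, hw, hwv⟩ := hlt
    exact (hmin w hw).trans_lt hwv
  have tilt : ∀ l : StrongDual ℝ E, (∀ x ∈ vert F \ {v}, l x < l v) →
      ∃ r > 0, ∀ x ∈ F, l (x - v) = r * c (x - v) := by
    intro l hl
    obtain ⟨r, hr, hle, w, hw, hwv, heq⟩ := exists_tilt hF.finite_vert l (-c) (l v) (-c v)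
      (fun x hx => by
        by_cases hxv : x = v
        · rw [hxv]
        · exact (hl x ⟨hx, hxv⟩).le)
      (fun x hx h => hl x ⟨hx, by rintro rfl; exact lt_irrefl _ h⟩)
      ⟨u, hu, by simpa using huv⟩
    have hexp := isExposed_setOf_eq (hF.le_of_forall_vert (l := l + r • (-c))
      (M := l v + r * -c v) (by simpa using hle))
    have hall : {x ∈ F | (l + r • (-c)) x = l v + r * -c v} = F := by
      by_contra hne
      refine (hG _ hexp hne ⟨hvF, by simp⟩ w ⟨vert_subset F hw, by simpa using heq⟩).not_gt ?_
      simpa using hwv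
    refine ⟨r, hr, fun x hx => ?_⟩
    rw [← hall] at hx
    have := hx.2
    simp only [add_apply, smul_apply, neg_apply, smul_eq_mul] at this
    simp only [map_sub]
    linarith
  obtain ⟨-, l, hl⟩ := hv
  have hl' : ∀ x ∈ vert F \ {v}, l x < l v := fun x hx => by
    by_contra! h
    exact hx.2 ((hl x (vert_subset F hx.1)).2 h)
  obtain ⟨r, hr, hlr⟩ := tilt l hl'
  have hcuv : c (u - v) < 0 := by rw [map_sub]; linarith
  have hcol : ∀ x ∈ F, c (u - v) • (x - v) = c (x - v) • (u - v) := by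
    intro x hx
    rw [← sub_eq_zero]
    refine SeparatingDual.eq_zero_of_forall_dual_eq_zero (R := ℝ) fun m => ?_
    obtain ⟨ε, hε, hm⟩ := exists_pos_forall_add_mul_neg (S := vert F \ {v})
      (hF.finite_vert.subset Set.sdiff_subset) (fun x => l (x - v)) (fun x => m (x - v))
      fun x hx => by rw [map_sub]; linarith [hl' x hx]
    obtain ⟨r', -, hr'⟩ := tilt (l + ε • m) fun x hx => by
      have := hm x hx
      simp only [map_sub] at this
      simp only [add_apply, smul_apply, smul_eq_mul]
      linarith
    have hmul : ∀ y ∈ F, ε * m (y - v) = (r' - r) * c (y - v) := fun y hy => by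
      have h1 := hr' y hy
      rw [add_apply, smul_apply, smul_eq_mul, hlr y hy] at h1
      linarith
    have h1 := hmul x hx
    have h2 := hmul u (vert_subset F hu)
    rw [map_sub, map_smul, map_smul, smul_eq_mul, smul_eq_mul]
    refine mul_left_cancel₀ hε.ne' ?_
    linear_combination c (u - v) * h1 - c (x - v) * h2
  refine ⟨u, hu, huv, ?_⟩
  suffices h : segment ℝ v u = F by rw [h]
  refine Set.Subset.antisymm (hF.convex.segment_subset hvF (vert_subset F hu)) fun x hx => ?_
  rw [segment_eq_image']
  refine ⟨c (x - v) / c (u - v), ⟨?_, ?_⟩, ?_⟩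
  · refine div_nonneg_of_nonpos ?_ hcuv.le
    have h1 := hlr x hx
    have h2 := (hl x hx).1
    by_contra! hpos
    have := mul_pos hr hpos
    rw [map_sub] at h1
    linarith
  · rw [div_le_one_of_neg hcuv, map_sub, map_sub]
    linarith [hmin x hx]
  · dsimp only
    rw [div_eq_inv_mul, mul_smul, ← hcol x hx, smul_smul, inv_mul_cancel₀ hcuv.ne, one_smul]
    abel

/-- Seen from `v`, each other point `p` of a polytope lies in front of some point `q` of a face
avoiding `v`. -/
theorem IsVPolytope.exists_face_segment {F : Set E} (hF : IsVPolytope F) {v p : E} (hp : p ∈ F)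
    (hpv : p ≠ v) :
    ∃ G, IsExposed ℝ F G ∧ v ∉ G ∧ ∃ q ∈ G, p ∈ segment ℝ v q := by
  have hpv' : 0 < ‖p - v‖ := norm_pos_iff.2 (sub_ne_zero.2 hpv)
  have hcomp : IsCompact {t : ℝ | v + t • (p - v) ∈ F} := by
    refine Metric.isCompact_of_isClosed_isBounded
      (hF.isCompact.isClosed.preimage (by fun_prop)) ?_
    obtain ⟨R, hR⟩ := hF.isCompact.isBounded.exists_norm_le
    refine (Metric.isBounded_iff_subset_closedBall 0).2 ⟨(R + ‖v‖) / ‖p - v‖, fun t ht => ?_⟩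
    rw [mem_closedBall_zero_iff, le_div_iff₀ hpv', ← norm_smul]
    calc ‖t • (p - v)‖ = ‖(v + t • (p - v)) - v‖ := by rw [add_sub_cancel_left]
      _ ≤ ‖v + t • (p - v)‖ + ‖v‖ := norm_sub_le _ _
      _ ≤ R + ‖v‖ := by gcongr; exact hR _ ht
  have h1 : (1 : ℝ) ∈ {t : ℝ | v + t • (p - v) ∈ F} := by simpa using hp
  obtain ⟨t, ht, hmax⟩ := hcomp.exists_isGreatest ⟨1, h1⟩
  have ht1 : 1 ≤ t := hmax h1
  have ht0 : 0 < t := one_pos.trans_le ht1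
  obtain ⟨q, hq⟩ : ∃ q, q = v + t • (p - v) := ⟨_, rfl⟩
  have hqF : q ∈ F := by rw [hq]; exact ht
  by_cases hsep : ∀ l : StrongDual ℝ E,
      (∀ x ∈ hF.finite_vert.toFinset, l (x - q) ≤ 0) → l (q - v) ≤ 0
  · exfalso
    obtain ⟨w, hw, hsum⟩ := exists_nonneg_combination _ (fun x => x - q) (q - v) hsep
    obtain ⟨W, hW⟩ : ∃ W, W = ∑ x ∈ hF.finite_vert.toFinset, w x := ⟨_, rfl⟩
    have hqv : q - v ≠ 0 := by
      rw [hq, add_sub_cancel_left]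
      exact smul_ne_zero ht0.ne' (sub_ne_zero.2 hpv)
    have hWpos : 0 < W := by
      refine (hW ▸ Finset.sum_nonneg hw).lt_of_ne' fun h0 => hqv ?_
      rw [hW, Finset.sum_eq_zero_iff_of_nonneg hw] at h0
      rw [hsum]
      exact Finset.sum_eq_zero fun x hx => by rw [h0 x hx, zero_smul]
    have hz : hF.finite_vert.toFinset.centerMass w id ∈ F :=
      hF.convex.centerMass_mem hw (hW ▸ hWpos)
        fun x hx => vert_subset F (hF.finite_vert.mem_toFinset.1 hx)
    have hzeq : hF.finite_vert.toFinset.centerMass w id = v + (t + W⁻¹ * t) • (p - v) := by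
      have h2 : W • q + (q - v) = ∑ x ∈ hF.finite_vert.toFinset, w x • x := by
        rw [hsum]
        simp only [smul_sub, Finset.sum_sub_distrib, ← Finset.sum_smul, ← hW]
        abel
      simp only [Finset.centerMass, id, ← hW, ← h2]
      rw [smul_add, smul_smul, inv_mul_cancel₀ hWpos.ne', one_smul, hq, add_sub_cancel_left,
        smul_smul, add_smul, add_assoc]
    rw [hzeq] at hz
    have := hmax hz
    have h3 : 0 < W⁻¹ * t := mul_pos (inv_pos.2 hWpos) ht0
    linarith
  · push Not at hsep
    obtain ⟨l, hl, hlv⟩ := hsep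
    have hle : ∀ x ∈ F, l x ≤ l q := hF.le_of_forall_vert fun x hx => by
      have := hl x (hF.finite_vert.mem_toFinset.2 hx)
      rw [map_sub] at this
      linarith
    refine ⟨_, isExposed_setOf_eq hle, fun h => ?_, q, ⟨hqF, rfl⟩, ?_⟩
    · rw [map_sub, h.2] at hlv
      linarith
    · rw [segment_eq_image']
      refine ⟨t⁻¹, ⟨(inv_pos.2 ht0).le, inv_le_one_of_one_le₀ ht1⟩, ?_⟩
      dsimp only
      rw [hq, add_sub_cancel_left, smul_smul, inv_mul_cancel₀ ht0.ne', one_smul]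
      abel

section FiniteDimensional

variable [FiniteDimensional ℝ E]

theorem dim_lt_of_isExposed {F G : Set E} (hG : IsExposed ℝ F G) (hne : G.Nonempty) {v : E}
    (hv : v ∈ F) (hvG : v ∉ G) : dim G < dim F := by
  refine Submodule.finrank_lt_finrank_of_lt
    ((vectorSpan_mono ℝ hG.subset).lt_of_ne fun h => hvG ?_)
  obtain ⟨l, M, hl, hGl⟩ := exists_eq_setOf_of_isExposed hG hne
  obtain ⟨g, hg⟩ := hne
  have hle : vectorSpan ℝ G ≤ LinearMap.ker l.toLinearMap := by
    rw [vectorSpan, Submodule.span_le]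
    rintro _ ⟨x, hx, y, hy, rfl⟩
    rw [hGl] at hx hy
    simp [hx.2, hy.2]
  have hmem : v -ᵥ g ∈ vectorSpan ℝ G := by
    rw [h]; exact vsub_mem_vectorSpan ℝ hv (hG.subset hg)
  have := hle hmem
  rw [hGl] at hg ⊢
  simp [hg.2, sub_eq_zero] at this
  exact ⟨hv, this⟩

/-- A face avoiding `v` lies in a facet avoiding `v`. -/
theorem IsVPolytope.exists_facet {F G : Set E} (hF : IsVPolytope F) (hG : IsExposed ℝ F G)
    (hne : G.Nonempty) {v : E} (hv : v ∈ F) (hvG : v ∉ G) :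
    ∃ H, IsExposed ℝ F H ∧ G ⊆ H ∧ v ∉ H ∧ dim H + 1 = dim F := by
  induction hn : (vert F).ncard - (vert G).ncard using Nat.strong_induction_on generalizing G with
  | _ n ih =>
  subst hn
  have hlt := dim_lt_of_isExposed hG hne hv hvG
  by_cases hdim : dim G + 1 = dim F
  · exact ⟨G, hG, subset_rfl, hvG, hdim⟩
  obtain ⟨l, M, hl, hGl⟩ := exists_eq_setOf_of_isExposed hG hne
  obtain ⟨g, hg⟩ := hne
  have hgF := hG.subset hg
  obtain ⟨w, hw, hwD⟩ : ∃ w ∈ F, w - g ∉ vectorSpan ℝ G ⊔ Submodule.span ℝ {v - g} := by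
    by_contra! hcon
    have hle : vectorSpan ℝ F ≤ vectorSpan ℝ G ⊔ Submodule.span ℝ {v - g} := by
      rw [vectorSpan_eq_span_vsub_set_right ℝ hgF, Submodule.span_le]
      rintro _ ⟨x, hx, rfl⟩
      exact hcon x hx
    have h1 := Submodule.finrank_mono hle
    have h2 := Submodule.finrank_add_le_finrank_add_finrank (vectorSpan ℝ G)
      (Submodule.span ℝ {v - g})
    have h3 : Module.finrank ℝ (Submodule.span ℝ {v - g}) ≤ 1 := by
      simpa using finrank_span_le_card (R := ℝ) ({v - g} : Set E)
    simp only [dim] at hlt hdim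
    omega
  obtain ⟨m, hmw, hm⟩ : ∃ m : StrongDual ℝ E, m g < m w ∧
      vectorSpan ℝ G ⊔ Submodule.span ℝ {v - g} ≤ LinearMap.ker m.toLinearMap := by
    obtain ⟨f, hfw, hf⟩ := Submodule.exists_le_ker_of_notMem hwD
    rcases lt_or_gt_of_ne hfw with h | h
    · refine ⟨-(LinearMap.toContinuousLinearMap f), ?_, fun x hx => ?_⟩
      · simp [map_sub] at h ⊢
        linarith
      · have := hf hx
        simpa using this
    · refine ⟨LinearMap.toContinuousLinearMap f, ?_, fun x hx => ?_⟩
      · simp [map_sub] at h ⊢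
        linarith
      · have := hf hx
        simpa using this
  have hmv : m v = m g := by
    have : m (v - g) = 0 := hm (Submodule.mem_sup_right (Submodule.mem_span_singleton_self _))
    rwa [map_sub, sub_eq_zero] at this
  have hmG : ∀ x ∈ G, m x = m g := fun x hx => by
    have : m (x - g) = 0 := hm (Submodule.mem_sup_left (vsub_mem_vectorSpan ℝ hx hg))
    rwa [map_sub, sub_eq_zero] at this
  have hlG : ∀ x ∈ F, x ∉ G → l x < M := fun x hx hxG =>
    (hl x hx).lt_of_ne fun h => hxG (by rw [hGl]; exact ⟨hx, h⟩)
  obtain ⟨r, hr, hle, z, hz, hzm, hzeq⟩ := exists_tilt hF.finite_vert l m M (m g)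
    (fun x hx => hl x (vert_subset F hx))
    (fun x hx h => hlG x (vert_subset F hx) fun hxG => h.ne' (hmG x hxG))
    (by
      by_contra! hcon
      exact hmw.not_ge (hF.le_of_forall_vert hcon w hw))
  have hexp := isExposed_setOf_eq (hF.le_of_forall_vert (l := l + r • m)
      (M := M + r * m g) (by simpa using hle))
  obtain ⟨H, hH⟩ : ∃ H, H = {x ∈ F | (l + r • m) x = M + r * m g} := ⟨_, rfl⟩
  rw [← hH] at hexp
  have hGH : G ⊆ H := fun x hx => by
    rw [hH]
    refine ⟨hG.subset hx, ?_⟩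
    rw [add_apply, smul_apply, smul_eq_mul, hmG x hx]
    rw [hGl] at hx
    rw [hx.2]
  have hvH : v ∉ H := fun h => by
    rw [hH] at h
    have h2 := h.2
    rw [add_apply, smul_apply, smul_eq_mul, hmv] at h2
    linarith [hlG v hv hvG]
  have hzH : z ∈ H := by
    rw [hH]
    exact ⟨vert_subset F hz, by simpa using hzeq⟩
  have hGexp : IsExposed ℝ H G := hG.mono hexp.subset hGH
  have hGne : G ≠ H := by
    rintro rfl
    exact hzm.ne' (hmG z hzH)
  have hcard := (hF.isExposed hexp).ncard_vert_lt hGexp hGne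
  have hcard' := hF.ncard_vert_lt hexp (by rintro rfl; exact hvH hv)
  obtain ⟨K, hK, hHK, hvK, hdK⟩ := ih _ (by omega) hexp ⟨z, hzH⟩ hvH rfl
  exact ⟨K, hK, hGH.trans hHK, hvK, hdK⟩

end FiniteDimensional

/-! ### The pulling complex -/

/-- The simplices of the triangulation of `P` obtained by pulling the vertices in increasing order
of `c`: each vertex `x` of the simplex minimizes `c` on a face of `P` that contains all the vertices
at which `c` is at least `c x`. -/
def IsPulling (P : Set E) (c : StrongDual ℝ E) (s : Finset E) : Prop :=
  (s : Set E) ⊆ vert P ∧ ∀ x ∈ s, ∃ F, IsExposed ℝ P F ∧ (∀ y ∈ s, c x ≤ c y → y ∈ F) ∧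
    ∀ z ∈ F, c x ≤ c z

section Pulling

variable {P : Set E} {c : StrongDual ℝ E} {s t : Finset E}

theorem IsPulling.mono (hs : IsPulling P c s) (hts : t ⊆ s) : IsPulling P c t :=
  ⟨(Finset.coe_subset.2 hts).trans hs.1, fun x hx => by
    obtain ⟨F, hF, hsF, hmin⟩ := hs.2 x (hts hx)
    exact ⟨F, hF, fun y hy => hsF y (hts hy), hmin⟩⟩

theorem IsPulling.exists_face (hs : IsPulling P c s) (hne : s.Nonempty) :
    ∃ x ∈ s, ∃ F, IsExposed ℝ P F ∧ (s : Set E) ⊆ F ∧ ∀ z ∈ F, c x ≤ c z := by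
  obtain ⟨x, hx, hmin⟩ := s.exists_min_image c hne
  obtain ⟨F, hF, hsF, hF'⟩ := hs.2 x hx
  exact ⟨x, hx, F, hF, fun y hy => hsF y hy (hmin y hy), hF'⟩

theorem isPulling_insert [DecidableEq E] {F : Set E} {v : E} (hF : IsExposed ℝ P F)
    (hv : v ∈ vert P) (hmin : ∀ z ∈ F, c v ≤ c z) (hvF : v ∈ F) (hs : IsPulling P c s)
    (hsF : (s : Set E) ⊆ F) (hlt : ∀ x ∈ s, c v < c x) : IsPulling P c (insert v s) := by
  refine ⟨by rw [Finset.coe_insert]; exact Set.insert_subset hv hs.1, fun x hx => ?_⟩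
  rcases Finset.mem_insert.1 hx with rfl | hxs
  · refine ⟨F, hF, fun y hy _ => ?_, hmin⟩
    rcases Finset.mem_insert.1 hy with rfl | hy
    exacts [hvF, hsF hy]
  · obtain ⟨G, hG, hsG, hG'⟩ := hs.2 x hxs
    refine ⟨G, hG, fun y hy hxy => ?_, hG'⟩
    rcases Finset.mem_insert.1 hy with rfl | hy
    exacts [absurd (hlt x hxs) hxy.not_gt, hsG y hy hxy]

theorem InGeneralPosition.eq (hc : InGeneralPosition P c) {v w : E} (hv : v ∈ vert P)
    (hw : w ∈ vert P) (h : c v = c w) : v = w := by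
  by_contra hne
  exact hc v hv w hw hne h

/-- A point of the cone over `P` is a positive combination of the vertices of at most one pulling
simplex. -/
theorem IsPulling.eq_of_sum_eq (hc : InGeneralPosition P c) (hs : IsPulling P c s)
    (ht : IsPulling P c t) {a b : E → ℝ} (ha : ∀ x ∈ s, 0 < a x) (hb : ∀ x ∈ t, 0 < b x)
    (hsum : ∑ x ∈ s, a x = ∑ x ∈ t, b x) (hvec : ∑ x ∈ s, a x • x = ∑ x ∈ t, b x • x) :
    s = t := by
  classical
  induction hn : s.card + t.card using Nat.strong_induction_on generalizing s t a b with
  | _ n ih =>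
  subst hn
  rcases s.eq_empty_or_nonempty with rfl | hsne
  · rcases t.eq_empty_or_nonempty with rfl | htne
    · rfl
    · exact absurd (Finset.sum_pos hb htne) (by rw [← hsum]; simp)
  rcases t.eq_empty_or_nonempty with rfl | htne
  · exact absurd (Finset.sum_pos ha hsne) (by rw [hsum]; simp)
  obtain ⟨v, hvs, F, hF, hsF, hvF⟩ := hs.exists_face hsne
  obtain ⟨w, hwt, G, hG, htG, hwG⟩ := ht.exists_face htne
  have hsG := subset_face_of_sum_eq hG (hs.1.trans (vert_subset P)) htG ha hsum hvec htne
  have htF := subset_face_of_sum_eq hF (ht.1.trans (vert_subset P)) hsF hb hsum.symm hvec.symm hsne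
  obtain rfl : v = w :=
    hc.eq (hs.1 hvs) (ht.1 hwt) ((hvF w (htF hwt)).antisymm (hwG v (hsG hvs)))
  have herase : ∀ (s t : Finset E) (a b : E → ℝ), v ∈ s → v ∈ t →
      ∑ x ∈ s, a x = ∑ x ∈ t, b x → ∑ x ∈ s, a x • x = ∑ x ∈ t, b x • x →
      ∑ x ∈ s.erase v, a x = ∑ x ∈ t, (b x - if x = v then a v else 0) ∧
      ∑ x ∈ s.erase v, a x • x = ∑ x ∈ t, (b x - if x = v then a v else 0) • x := by
    intro s t a b hvs hvt h1 h2
    constructor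
    · rw [Finset.sum_erase_eq_sub hvs, h1, Finset.sum_sub_distrib, Finset.sum_ite_eq' t v,
        if_pos hvt]
    · simp only [sub_smul, ite_smul, zero_smul]
      rw [Finset.sum_erase_eq_sub hvs, h2, Finset.sum_sub_distrib, Finset.sum_ite_eq' t v,
        if_pos hvt]
  rcases lt_trichotomy (a v) (b v) with hab | hab | hab
  · obtain ⟨h1, h2⟩ := herase s t a b hvs hwt hsum hvec
    have := ih _ (by have := Finset.card_erase_lt_of_mem hvs; omega)
      (hs.mono (Finset.erase_subset v s)) ht (fun x hx => ha x (Finset.mem_of_mem_erase hx))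
      (fun x hx => by
        split_ifs with hxv
        · rw [hxv]; linarith
        · rw [sub_zero]; exact hb x hx) h1 h2 rfl
    rw [← this] at hwt
    simp at hwt
  · have h1 : ∑ x ∈ s.erase v, a x = ∑ x ∈ t.erase v, b x := by
      rw [Finset.sum_erase_eq_sub hvs, Finset.sum_erase_eq_sub hwt, hsum, hab]
    have h2 : ∑ x ∈ s.erase v, a x • x = ∑ x ∈ t.erase v, b x • x := by
      rw [Finset.sum_erase_eq_sub hvs, Finset.sum_erase_eq_sub hwt, hvec, hab]
    have := ih _ (by
        have := Finset.card_erase_lt_of_mem hvs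
        have := Finset.card_erase_lt_of_mem hwt
        omega)
      (hs.mono (Finset.erase_subset v s)) (ht.mono (Finset.erase_subset v t))
      (fun x hx => ha x (Finset.mem_of_mem_erase hx))
      (fun x hx => hb x (Finset.mem_of_mem_erase hx)) h1 h2 rfl
    rw [← Finset.insert_erase hvs, this, Finset.insert_erase hwt]
  · obtain ⟨h1, h2⟩ := herase t s b a hwt hvs hsum.symm hvec.symm
    have := ih _ (by have := Finset.card_erase_lt_of_mem hwt; omega) hs
      (ht.mono (Finset.erase_subset v t))
      (fun x hx => by
        split_ifs with hxv
        · rw [hxv]; linarith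
        · rw [sub_zero]; exact ha x hx)
      (fun x hx => hb x (Finset.mem_of_mem_erase hx)) h1.symm h2.symm rfl
    rw [this] at hvs
    simp at hvs

theorem sum_eq_sum_pos_add_sum_neg {ι M : Type*} [AddCommMonoid M] (u : Finset ι) (f : ι → ℝ)
    (g : ι → M) (hg : ∀ x, f x = 0 → g x = 0) :
    ∑ x ∈ u, g x = ∑ x ∈ u with 0 < f x, g x + ∑ x ∈ u with f x < 0, g x := by
  rw [← Finset.sum_filter_add_sum_filter_not u (fun x => 0 < f x)]
  congr 1
  rw [Finset.sum_filter, Finset.sum_filter]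
  refine Finset.sum_congr rfl fun x _ => ?_
  rcases lt_trichotomy (f x) 0 with h | h | h
  · simp [h, h.le]
  · simp [h, hg x h]
  · simp [h, h.le]

theorem IsPulling.affineIndependent (hc : InGeneralPosition P c) (hs : IsPulling P c s) :
    AffineIndependent ℝ ((↑) : s → E) := by
  classical
  rw [affineIndependent_iff]
  intro u w hw hvec e he
  obtain ⟨f, hf⟩ : ∃ f : E → ℝ, ∀ i : s, f i = w i :=
    ⟨fun x => if h : x ∈ s then w ⟨x, h⟩ else 0, fun i => by simp⟩
  obtain ⟨u', hu', rfl⟩ : ∃ u' : Finset E, u' ⊆ s ∧ u'.subtype (· ∈ s) = u :=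
    ⟨u.map (Function.Embedding.subtype _), fun x hx => by
      obtain ⟨y, -, rfl⟩ := Finset.mem_map.1 hx; exact y.2, by ext; simp⟩
  have h1 : ∑ x ∈ u', f x = 0 := by
    rw [← hw, ← Finset.sum_subtype_of_mem f hu']
    exact Finset.sum_congr rfl fun i _ => hf i
  have h2 : ∑ x ∈ u', f x • x = 0 := by
    rw [← hvec, ← Finset.sum_subtype_of_mem (fun x => f x • x) hu']
    exact Finset.sum_congr rfl fun i _ => by rw [hf i]
  have h3 := sum_eq_sum_pos_add_sum_neg u' f f fun x h => h
  have h4 := sum_eq_sum_pos_add_sum_neg u' f (fun x => f x • x) fun x h => by rw [h, zero_smul]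
  rw [h1] at h3
  rw [h2] at h4
  have heq : u'.filter (fun x => 0 < f x) = u'.filter (fun x => f x < 0) := by
    refine IsPulling.eq_of_sum_eq hc (hs.mono ((Finset.filter_subset _ _).trans hu'))
      (hs.mono ((Finset.filter_subset _ _).trans hu')) (a := f) (b := fun x => -f x)
      (fun x hx => (Finset.mem_filter.1 hx).2)
      (fun x hx => neg_pos.2 (Finset.mem_filter.1 hx).2) ?_ ?_
    · rw [Finset.sum_neg_distrib]; exact eq_neg_of_add_eq_zero_left h3.symm
    · simp only [neg_smul]
      rw [Finset.sum_neg_distrib]; exact eq_neg_of_add_eq_zero_left h4.symm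
  rw [← hf e]
  have heu : (e : E) ∈ u' := by simpa using he
  rcases lt_trichotomy (f e) 0 with h | h | h
  · have : (e : E) ∈ u'.filter (fun x => f x < 0) := Finset.mem_filter.2 ⟨heu, h⟩
    rw [← heq] at this
    exact absurd (Finset.mem_filter.1 this).2 h.not_gt
  · exact h
  · have : (e : E) ∈ u'.filter (fun x => 0 < f x) := Finset.mem_filter.2 ⟨heu, h⟩
    rw [heq] at this
    exact absurd (Finset.mem_filter.1 this).2 h.not_gt

theorem IsPulling.inter_subset_convexHull (hc : InGeneralPosition P c) (hs : IsPulling P c s)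
    (ht : IsPulling P c t) :
    convexHull ℝ (s : Set E) ∩ convexHull ℝ (t : Set E) ⊆ convexHull ℝ (s ∩ t : Set E) := by
  rintro p ⟨hps, hpt⟩
  obtain ⟨u, hu, a, ha, ha1, hap⟩ := exists_pos_combination hps
  obtain ⟨u', hu', b, hb, hb1, hbp⟩ := exists_pos_combination hpt
  obtain rfl := IsPulling.eq_of_sum_eq hc (hs.mono hu) (ht.mono hu') ha hb (ha1.trans hb1.symm)
    (hap.trans hbp.symm)
  refine convexHull_mono (Set.subset_inter (Finset.coe_subset.2 hu) (Finset.coe_subset.2 hu')) ?_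
  exact Finset.mem_convexHull'.2 ⟨a, fun x hx => (ha x hx).le, ha1, hap⟩

/-- The complex of the pulling simplices of `P`. -/
def pullingComplex (P : Set E) (c : StrongDual ℝ E) (hc : InGeneralPosition P c) :
    SimplicialComplex ℝ E where
  faces := {s | s.Nonempty ∧ IsPulling P c s}
  isRelLowerSet_faces := fun _ hs => ⟨hs.1, fun _ hts ht => ⟨ht, hs.2.mono hts⟩⟩
  indep := fun hs => hs.2.affineIndependent hc
  inter_subset_convexHull := fun hs ht => hs.2.inter_subset_convexHull hc ht.2

theorem IsPulling.lt_of_notMem (hc : InGeneralPosition P c) {v : E} (hv : v ∈ vert P) {F : Set E}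
    (hmin : ∀ z ∈ F, c v ≤ c z) (hs : IsPulling P c s) (hsF : (s : Set E) ⊆ F) (hvs : v ∉ s) :
    ∀ x ∈ s, c v < c x := fun x hx =>
  (hmin x (hsF hx)).lt_of_ne fun h => hvs (hc.eq hv (hs.1 hx) h ▸ hx)

/-- The pulling simplices in a face cover it. -/
theorem IsVPolytope.exists_isPulling (hP : IsVPolytope P) (hc : InGeneralPosition P c) {F : Set E}
    (hF : IsExposed ℝ P F) {p : E} (hp : p ∈ F) :
    ∃ s, IsPulling P c s ∧ (s : Set E) ⊆ F ∧ p ∈ convexHull ℝ (s : Set E) := by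
  classical
  induction hn : (vert F).ncard using Nat.strong_induction_on generalizing F p with
  | _ n ih =>
  subst hn
  have hFV := hP.isExposed hF
  obtain ⟨v, hv, hmin⟩ := hFV.exists_vert_forall_le ⟨p, hp⟩ c
  have hvF := vert_subset F hv
  have hvP : v ∈ vert P := by rw [hP.vert_face hF] at hv; exact hv.1
  by_cases hpv : p = v
  · refine ⟨{v}, ?_, by simpa using hvF, by simp [hpv]⟩
    have hempty : IsPulling P c ∅ := ⟨by simp, by simp⟩
    exact isPulling_insert hF hvP hmin hvF hempty (by simp) (by simp)
  · obtain ⟨G, hG, hvG, q, hq, hpq⟩ := hFV.exists_face_segment hp hpv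
    obtain ⟨s, hs, hsG, hqs⟩ := ih _ (hFV.ncard_vert_lt hG (by rintro rfl; exact hvG hvF))
      (hP.isExposed_trans hF hG) hq rfl
    have hsF := hsG.trans hG.subset
    refine ⟨insert v s, isPulling_insert hF hvP hmin hvF hs hsF
      (hs.lt_of_notMem hc hvP hmin hsF fun h => hvG (hsG h)), ?_, ?_⟩
    · rw [Finset.coe_insert]; exact Set.insert_subset hvF hsF
    · refine (convex_convexHull ℝ _).segment_subset (subset_convexHull ℝ _ (by simp)) ?_ hpq
      exact convexHull_mono (by simp) hqs

/-- A pulling simplex in `F` avoiding the vertex of `F` that minimizes `c` lies in a face of `F`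
avoiding that vertex. -/
theorem IsPulling.exists_face_notMem (hc : InGeneralPosition P c) {v : E} (hv : v ∈ vert P)
    {F : Set E} (hF : IsExposed ℝ P F) (hmin : ∀ z ∈ F, c v ≤ c z) (hs : IsPulling P c s)
    (hsF : (s : Set E) ⊆ F) (hvs : v ∉ s) (hne : s.Nonempty) :
    ∃ G, IsExposed ℝ F G ∧ (s : Set E) ⊆ G ∧ v ∉ G := by
  obtain ⟨x, hx, G, hG, hsG, hxG⟩ := hs.exists_face hne
  refine ⟨F ∩ G, (hF.inter hG).mono hF.subset Set.inter_subset_left, Set.subset_inter hsF hsG,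
    fun h => ?_⟩
  exact (hs.lt_of_notMem hc hv hmin hsF hvs x hx).not_ge (hxG v h.2)

variable [FiniteDimensional ℝ E]

theorem IsPulling.card_le (hc : InGeneralPosition P c) (hs : IsPulling P c s) {F : Set E}
    (hsF : (s : Set E) ⊆ F) : s.card ≤ dim F + 1 := by
  have h1 := (hs.affineIndependent hc).card_le_finrank_succ
  have h2 := Submodule.finrank_mono (vectorSpan_mono ℝ (Subtype.range_coe.trans_subset hsF))
  rw [Fintype.card_coe] at h1
  exact h1.trans (Nat.add_le_add_right h2 1)

theorem IsPulling.mem_of_card_eq (hc : InGeneralPosition P c) {v : E} (hv : v ∈ vert P)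
    {F : Set E} (hF : IsExposed ℝ P F) (hvF : v ∈ F) (hmin : ∀ z ∈ F, c v ≤ c z)
    (hs : IsPulling P c s) (hsF : (s : Set E) ⊆ F) (hcard : s.card = dim F + 1) : v ∈ s := by
  by_contra hvs
  have hne : s.Nonempty := Finset.card_pos.1 (by omega)
  obtain ⟨G, hG, hsG, hvG⟩ := hs.exists_face_notMem hc hv hF hmin hsF hvs hne
  have h1 := hs.card_le hc hsG
  have h2 := dim_lt_of_isExposed hG (hne.to_set.mono hsG) hvF hvG
  omega

/-- Each pulling simplex in a face extends to one of full dimension in this face. -/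
theorem IsVPolytope.exists_isPulling_card (hP : IsVPolytope P) (hc : InGeneralPosition P c)
    {F : Set E} (hF : IsExposed ℝ P F) (hne : F.Nonempty) (hs : IsPulling P c s)
    (hsF : (s : Set E) ⊆ F) :
    ∃ t, IsPulling P c t ∧ (t : Set E) ⊆ F ∧ s ⊆ t ∧ t.card = dim F + 1 := by
  classical
  induction hn : (vert F).ncard using Nat.strong_induction_on generalizing F s with
  | _ n ih =>
  subst hn
  have hFV := hP.isExposed hF
  obtain ⟨v, hv, hmin⟩ := hFV.exists_vert_forall_le hne c
  have hvF := vert_subset F hv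
  have hvP : v ∈ vert P := by rw [hP.vert_face hF] at hv; exact hv.1
  have hs' := hs.mono (Finset.erase_subset v s)
  have hsF' : ((s.erase v : Finset E) : Set E) ⊆ F :=
    (Finset.coe_subset.2 (Finset.erase_subset v s)).trans hsF
  by_cases hsing : F = {v}
  · refine ⟨insert v s, ?_, ?_, Finset.subset_insert v s, ?_⟩
    · rw [show insert v s = insert v (s.erase v) by ext; simp; tauto]
      exact isPulling_insert hF hvP hmin hvF hs' hsF'
        (hs'.lt_of_notMem hc hvP hmin hsF' (by simp))
    · rw [Finset.coe_insert]; exact Set.insert_subset hvF hsF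
    · have : insert v s = {v} := by
        refine Finset.Subset.antisymm (fun x hx => ?_) (by simp)
        rcases Finset.mem_insert.1 hx with rfl | hx
        · simp
        · have := hsF hx
          rw [hsing] at this
          simpa using this
      rw [this, hsing, dim, vectorSpan_singleton, finrank_bot, Finset.card_singleton]
  obtain ⟨G, hG, hsG, hvG, hGne⟩ : ∃ G, IsExposed ℝ F G ∧ ((s.erase v : Finset E) : Set E) ⊆ G ∧
      v ∉ G ∧ G.Nonempty := by
    rcases (s.erase v).eq_empty_or_nonempty with he | he
    · obtain ⟨p, hp, hpv⟩ : ∃ p ∈ F, p ≠ v := by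
        by_contra! hcon
        exact hsing (Set.Subset.antisymm hcon (by simpa using hvF))
      obtain ⟨G, hG, hvG, q, hq, -⟩ := hFV.exists_face_segment hp hpv
      exact ⟨G, hG, by simp [he], hvG, q, hq⟩
    · obtain ⟨G, hG, hsG, hvG⟩ := hs'.exists_face_notMem hc hvP hF hmin hsF' (by simp) he
      exact ⟨G, hG, hsG, hvG, he.to_set.mono hsG⟩
  obtain ⟨H, hH, hGH, hvH, hdim⟩ := hFV.exists_facet hG hGne hvF hvG
  obtain ⟨t, ht, htH, hst, hcard⟩ := ih _ (hFV.ncard_vert_lt hH (by rintro rfl; exact hvH hvF))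
    (hP.isExposed_trans hF hH) (hGne.mono hGH) hs' (hsG.trans hGH) rfl
  have hvt : v ∉ t := fun h => hvH (htH h)
  have htF := htH.trans hH.subset
  refine ⟨insert v t, isPulling_insert hF hvP hmin hvF ht htF
    (ht.lt_of_notMem hc hvP hmin htF hvt), ?_, Finset.subset_insert_iff.2 hst, ?_⟩
  · rw [Finset.coe_insert]; exact Set.insert_subset hvF htF
  · rw [Finset.card_insert_of_notMem hvt, hcard, hdim]

end Pulling

/-! ### Sinks -/

theorem IsVPolytope.isSink_iff {P F : Set E} {c : StrongDual ℝ E} {v : E} (hP : IsVPolytope P)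
    (hF : IsExposed ℝ P F) : IsSink P c F v ↔ v ∈ vert F ∧ ∀ x ∈ F, c v ≤ c x := by
  refine and_congr_right fun hv => ⟨fun h => ?_, fun h w hw hvw => ?_⟩
  · by_contra! hcon
    obtain ⟨w, hw, hlt, hexp⟩ := (hP.isExposed hF).exists_edge_lt hv hcon
    refine h w hw ⟨⟨fun h => hlt.ne (by rw [h]), ?_, ?_, hP.isExposed_trans hF hexp⟩, hlt⟩
    · rw [hP.vert_face hF] at hv; exact hv.1
    · rw [hP.vert_face hF] at hw; exact hw.1
  · exact (h w (vert_subset F hw)).not_gt hvw.2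

theorem IsVPolytope.existsUnique_isSink {P F : Set E} {c : StrongDual ℝ E} (hP : IsVPolytope P)
    (hc : InGeneralPosition P c) (hF : IsNonemptyFace P F) : ∃! v, IsSink P c F v := by
  obtain ⟨v, hv, hmin⟩ := (hP.isExposed hF.1).exists_vert_forall_le hF.2 c
  refine ⟨v, (hP.isSink_iff hF.1).2 ⟨hv, hmin⟩, fun w hw => ?_⟩
  obtain ⟨hw, hw'⟩ := (hP.isSink_iff hF.1).1 hw
  refine hc.eq ?_ ?_ ((hw' v (vert_subset F hv)).antisymm (hmin w (vert_subset F hw)))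
  · rw [hP.vert_face hF.1] at hw; exact hw.1
  · rw [hP.vert_face hF.1] at hv; exact hv.1

/-! ### H-polytopes and general position -/

variable [FiniteDimensional ℝ E]

theorem IsHPolytope.isVPolytope {P : Set E} (hP : IsHPolytope P) : IsVPolytope P := by
  obtain ⟨hbdd, m, a, z, hPa⟩ := hP
  have hP_eq : P = ⋂ i, {x | a i x ≤ z i} := by rw [hPa]; ext; simp
  have hclosed : IsClosed P := by
    rw [hP_eq]
    exact isClosed_iInter fun i => isClosed_le (a i).continuous continuous_const
  have hconv : Convex ℝ P := by
    rw [hP_eq]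
    exact convex_iInter fun i => convex_halfSpace_le (a i).isLinear (z i)
  have := FiniteDimensional.proper_real E
  have hcomp : IsCompact P := Metric.isCompact_of_isClosed_isBounded hclosed hbdd
  have hinj : Set.InjOn (fun x => {i | a i x = z i}) (P.extremePoints ℝ) := by
    intro x hx y hy hxy
    have hact : ∀ i, a i x = z i → a i y = z i := fun i hi =>
      (Set.ext_iff.1 hxy i).1 hi
    obtain ⟨ε, hε, hlt⟩ := exists_pos_forall_add_mul_neg (S := {i | a i x < z i}) (Set.toFinite _)
      (fun i => a i x - z i) (fun i => |a i (y - x)|) fun i hi => sub_neg.2 hi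
    have hmem : ∀ δ : ℝ, |δ| ≤ ε → x + δ • (y - x) ∈ P := by
      intro δ hδ
      rw [hPa]
      intro i
      rw [map_add, map_smul, smul_eq_mul]
      have hxi : a i x ≤ z i := by have := hx.1; rw [hPa] at this; exact this i
      rcases hxi.lt_or_eq with h | h
      · have h1 : δ * a i (y - x) ≤ ε * |a i (y - x)| := by
          refine (le_abs_self _).trans ?_
          rw [abs_mul]
          gcongr
        linarith [hlt i h]
      · rw [map_sub, h, hact i h]
        simp
    have h1 := hmem ε (abs_of_pos hε).le
    have h2 := hmem (-ε) (by rw [abs_neg, abs_of_pos hε])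
    have h3 := (mem_extremePoints.1 hx).2 _ h1 _ h2
      ⟨1 / 2, 1 / 2, by norm_num, by norm_num, by norm_num, by module⟩
    have h4 : ε • (y - x) = 0 := by simpa using h3.1
    exact (sub_eq_zero.1 ((smul_eq_zero.1 h4).resolve_left hε.ne')).symm
  have hfin : (P.extremePoints ℝ).Finite := Set.Finite.of_finite_image (Set.toFinite _) hinj
  refine ⟨hfin.toFinset, ?_⟩
  rw [hfin.coe_toFinset, ← (hfin.isClosed_convexHull ℝ).closure_eq,
    closure_convexHull_extremePoints hcomp hconv]

theorem IsPolytope.isVPolytope {P : Set E} (hP : IsPolytope P) : IsVPolytope P :=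
  hP.elim id IsHPolytope.isVPolytope

theorem IsVPolytope.exists_inGeneralPosition {P : Set E} (hP : IsVPolytope P) :
    ∃ c : StrongDual ℝ E, InGeneralPosition P c := by
  have := hP.finite_vert.to_subtype
  obtain ⟨f, hf⟩ := Module.exists_dual_forall_apply_ne_zero (K := ℝ)
    (fun p : {p : vert P × vert P // p.1 ≠ p.2} => (p.1.1 : E) - p.1.2)
    fun p => sub_ne_zero.2 fun h => p.2 (Subtype.ext h)
  refine ⟨LinearMap.toContinuousLinearMap f, fun v hv w hw hne h => ?_⟩
  refine hf ⟨(⟨v, hv⟩, ⟨w, hw⟩), fun h => hne (congrArg Subtype.val h)⟩ ?_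
  simpa [sub_eq_zero] using h

/-! ### The pulling complex is a pointed triangulation -/

theorem IsVPolytope.isPointedTriangulation_pullingComplex {P : Set E} {c : StrongDual ℝ E}
    (hP : IsVPolytope P) (hc : InGeneralPosition P c) {apex : Set E → E}
    (hapex : ∀ F, IsNonemptyFace P F → IsSink P c F (apex F)) :
    IsPointedTriangulation P (pullingComplex P c hc) apex := by
  classical
  have hvert : ∀ F, IsNonemptyFace P F → apex F ∈ vert P ∧ apex F ∈ F ∧
      ∀ x ∈ F, c (apex F) ≤ c x := fun F hF => by
    obtain ⟨h1, h2⟩ := (hP.isSink_iff hF.1).1 (hapex F hF)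
    exact ⟨by rw [hP.vert_face hF.1] at h1; exact h1.1, vert_subset F h1, h2⟩
  have hfin : (pullingComplex P c hc).faces.Finite := by
    refine hP.finite_vert.toFinset.powerset.finite_toSet.subset fun s hs => ?_
    rw [Finset.mem_coe, Finset.mem_powerset]
    exact fun x hx => hP.finite_vert.mem_toFinset.2 (hs.2.1 hx)
  have hmem : ∀ F, IsExposed ℝ P F → ∀ s, s ∈ (restrict (pullingComplex P c hc) F).faces ↔
      s.Nonempty ∧ IsPulling P c s ∧ (s : Set E) ⊆ F := fun F hF s => by
    refine ⟨fun h => ⟨h.1.1, h.1.2, (subset_convexHull ℝ _).trans h.2⟩, fun h => ⟨⟨h.1, h.2.1⟩, ?_⟩⟩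
    exact convexHull_min h.2.2 (hF.convex hP.convex)
  have hspace : ∀ F, IsExposed ℝ P F → (restrict (pullingComplex P c hc) F).space = F := by
    intro F hF
    ext p
    rw [SimplicialComplex.mem_space_iff]
    refine ⟨fun ⟨s, hs, hps⟩ => hs.2 hps, fun hp => ?_⟩
    obtain ⟨s, hs, hsF, hps⟩ := hP.exists_isPulling hc hF hp
    refine ⟨s, (hmem F hF s).2 ⟨?_, hs, hsF⟩, hps⟩
    exact Finset.coe_nonempty.1 (convexHull_nonempty_iff.1 ⟨p, hps⟩)
  refine ⟨⟨hfin, ?_⟩, fun F hF => ⟨hfin.subset fun s hs => hs.1, hspace F hF.1⟩, ?_, ?_, ?_, ?_, ?_⟩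
  · refine Set.Subset.antisymm (fun p hp => ?_) ?_
    · obtain ⟨s, hs, hps⟩ := SimplicialComplex.mem_space_iff.1 hp
      exact convexHull_min (hs.2.1.trans (vert_subset P)) hP.convex hps
    · conv_lhs => rw [← hspace P (IsExposed.refl P)]
      exact Set.biUnion_subset_biUnion_left fun s hs => hs.1
  · intro F hF s hs
    obtain ⟨hne, hs, hsF⟩ := (hmem F hF.1 s).1 hs
    obtain ⟨t, ht, htF, hst, hcard⟩ := hP.exists_isPulling_card hc hF.1 hF.2 hs hsF
    exact ⟨t, (hmem F hF.1 t).2 ⟨hne.mono hst, ht, htF⟩, hst, hcard⟩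
  · exact fun F hF => (hapex F hF).1
  · intro F hF t ht hcard
    obtain ⟨-, ht, htF⟩ := (hmem F hF.1 t).1 ht
    obtain ⟨h1, h2, h3⟩ := hvert F hF
    exact subset_convexHull ℝ _ (ht.mem_of_card_eq hc h1 hF.1 h2 h3 htF hcard)
  · intro F₁ F₂ hF₁ hF₂ h₁ h₂
    obtain ⟨hv₁, -, hmin₁⟩ := hvert F₁ hF₁
    obtain ⟨hv₂, -, hmin₂⟩ := hvert F₂ hF₂
    exact hc.eq hv₁ hv₂ ((hmin₁ _ h₂.1).antisymm (hmin₂ _ h₁.2))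
  · intro F hF w hw hne
    obtain ⟨h1, h2, h3⟩ := hvert F hF
    have hwF := vert_subset F hw
    rw [hP.vert_face hF.1] at hw
    have hempty : IsPulling P c ∅ := ⟨by simp, by simp⟩
    have hw' : IsPulling P c {w} :=
      isPulling_insert (mem_exposedPoints_iff_exposed_singleton.1 hw.1) hw.1 (by simp) rfl hempty
        (by simp) (by simp)
    refine ⟨{apex F, w}, (hmem F hF.1 _).2 ⟨by simp, ?_, ?_⟩, by simp⟩
    · refine isPulling_insert hF.1 h1 h3 h2 hw' (by simpa using hwF) ?_
      exact hw'.lt_of_notMem hc h1 h3 (by simpa using hwF) (by simpa using hne.symm)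
    · simpa [Set.insert_subset_iff] using ⟨h2, hwF⟩

end PointedTriangulation

theorem mainTheorem2 (n : ℕ) (P : Set (EuclideanSpace ℝ (Fin n)))
    (hP : PointedTriangulation.IsPolytope P) :
    (∃ c : StrongDual ℝ (EuclideanSpace ℝ (Fin n)),
      PointedTriangulation.InGeneralPosition P c) ∧
    ∀ c : StrongDual ℝ (EuclideanSpace ℝ (Fin n)),
      PointedTriangulation.InGeneralPosition P c →
      (∀ F, PointedTriangulation.IsNonemptyFace P F →
        ∃! v, PointedTriangulation.IsSink P c F v) ∧
      ∃ (K : Geometry.SimplicialComplex ℝ (EuclideanSpace ℝ (Fin n)))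
        (apex : Set (EuclideanSpace ℝ (Fin n)) → EuclideanSpace ℝ (Fin n)),
        PointedTriangulation.IsPointedTriangulation P K apex ∧
        ∀ F, PointedTriangulation.IsNonemptyFace P F →
          PointedTriangulation.IsSink P c F (apex F) := by
  have hV := hP.isVPolytope
  refine ⟨hV.exists_inGeneralPosition, fun c hc =>
    ⟨fun F hF => hV.existsUnique_isSink hc hF, ?_⟩⟩
  have hsink : ∀ F, PointedTriangulation.IsNonemptyFace P F →
      ∃ v, PointedTriangulation.IsSink P c F v :=
    fun F hF => (hV.existsUnique_isSink hc hF).exists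
  choose! apex hapex using hsink
  exact ⟨_, apex, hV.isPointedTriangulation_pullingComplex hc hapex, hapex⟩
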